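/- **Conventions.** For a prime $p$ and $A\subseteq(\mathbb Z/p\mathbb Z)\setminus\{0\}$, the circulant digraph $G(p;A)$ has vertex set $\mathbb Z/p\mathbb Z$ and an arc from $u$ to $v$ iff $v-u\in A$; if $A=-A$ it may be regarded as an undirected graph, the circulant graph $G(p;A)$. More generally, for $k\ge 0$, a nonsingular $M\in\mathbb Z^{k\times k}$ and $A\subseteq\mathbb Z^k/M\mathbb Z^k$ with $0\notin A$, the multidimensional circulant digraph $G(M;A)$ has vertex set $\mathbb Z^k/M\mathbb Z^k$ and an arc from $u$ to $v$ iff $v-u\in A$; if $A=-A$ it may be regarded as an undirected graph, the multidimensional circulant graph $G(M;A)$. The dimension of a multidimensional circulant digraph (respectively graph) is the least $k$ such that it is isomorphic to a multidimensional circulant digraph (respectively graph) $G(M';A')$ with $M'\in\mathbb Z^{k\times k}$ nonsingular. A digraph is called connected if its underlying undirected graph is connected. The cartesian product of a family $(G_i)$ of (di)graphs has as vertices the tuples $(u_i)$ with $u_i$ a vertex of $G_i$, and $u$ is adjacent to $v$ iff for some $i$, $u_i$ is adjacent to $v_i$ in $G_i$ and $u_j=v_j$ for all $j\ne i$. A subgroup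 of the automorphism group of a finite (di)graph is regular if it is transitive on the vertices and its order is the number of vertices. **Theorem 3.7.** Let $p>2$ be a prime, let $n\ge 0$, and let $G_1=G(p;A_1),\dots,G_n=G(p;A_n)$ be connected circulants with $p$ vertices, all digraphs or all graphs. Let $M=\operatorname{diag}(p,\dots,p)\in\mathbb Z^{n\times n}$ and $A=\{a\,\mathbf e_i : a\in A_i,\ 1\le i\le n\}\subseteq \mathbb Z^n/M\mathbb Z^n$, where $\mathbf e_i$ is the $i$-th unit vector. Then the multidimensional circulant $G(M;A)$ is isomorphic to the cartesian product $G_1\times\cdots\times G_n$, it has dimension exactly $n$, and every regular abelian subgroup of $\operatorname{Aut}G(M;A)$ is isomorphic to $(\mathbb Z/p\mathbb Z)^n$. -/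

import Mathlib

/-- The group `ℤᵏ / M ℤᵏ` of integral vectors modulo the integral matrix `M`. -/
abbrev IntVecMod {k : ℕ} (M : Matrix (Fin k) (Fin k) ℤ) : Type :=
  (Fin k → ℤ) ⧸ LinearMap.range M.mulVecLin

/-- The Cayley digraph of an abelian group with set of steps `A`:
each vertex `u` is adjacent to the vertices of `u + A`. -/
def stepDigraph {Γ : Type*} [AddCommGroup Γ] (A : Set Γ) : Digraph Γ where
  Adj u v := v - u ∈ A

/-- The circulant digraph `G(m; A)`. -/
def circDigraph (m : ℕ) (A : Set (ZMod m)) : Digraph (ZMod m) :=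
  stepDigraph A

/-- The circulant graph `G(m; A)`, where the set of steps is meant to satisfy `A = -A`
and `0 ∉ A`. -/
def circGraph (m : ℕ) (A : Set (ZMod m)) : SimpleGraph (ZMod m) :=
  SimpleGraph.circulantGraph A

/-- The multidimensional circulant digraph `G(M; A)`. -/
def multiCircDigraph {k : ℕ} (M : Matrix (Fin k) (Fin k) ℤ) (A : Set (IntVecMod M)) :
    Digraph (IntVecMod M) :=
  stepDigraph A

/-- The multidimensional circulant graph `G(M; A)`, where the set of steps is meant to satisfy
`A = -A` and `0 ∉ A`. -/
def multiCircGraph {k : ℕ} (M : Matrix (Fin k) (Fin k) ℤ) (A : Set (IntVecMod M)) :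
    SimpleGraph (IntVecMod M) :=
  SimpleGraph.circulantGraph A

/-- `G` has dimension `d` as a multidimensional circulant digraph: `d` is the least `k` such that
`G` is isomorphic to `G(M; A)` for a nonsingular `k × k` integral matrix `M`. -/
def Digraph.HasCircDim {V : Type*} (G : Digraph V) (d : ℕ) : Prop :=
  IsLeast {k : ℕ | ∃ (M : Matrix (Fin k) (Fin k) ℤ) (A : Set (IntVecMod M)),
    M.det ≠ 0 ∧ 0 ∉ A ∧ Nonempty (G.Adj ≃r (multiCircDigraph M A).Adj)} d

/-- `G` has dimension `d` as a multidimensional circulant graph: `d` is the least `k` such that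
`G` is isomorphic to `G(M; A)` for a nonsingular `k × k` integral matrix `M` and a symmetric set
of steps `A`. -/
def SimpleGraph.HasCircDim {V : Type*} (G : SimpleGraph V) (d : ℕ) : Prop :=
  IsLeast {k : ℕ | ∃ (M : Matrix (Fin k) (Fin k) ℤ) (A : Set (IntVecMod M)),
    M.det ≠ 0 ∧ 0 ∉ A ∧ -A = A ∧ Nonempty (G ≃g multiCircGraph M A)} d

/-- The cartesian product of a family of digraphs. -/
def Digraph.cartProd {ι : Type*} {V : ι → Type*} (G : ∀ i, Digraph (V i)) :
    Digraph (∀ i, V i) where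
  Adj u v := ∃ i, (G i).Adj (u i) (v i) ∧ ∀ j, j ≠ i → u j = v j

/-- The cartesian product of a family of graphs. -/
def SimpleGraph.cartProd {ι : Type*} {V : ι → Type*} (G : ∀ i, SimpleGraph (V i)) :
    SimpleGraph (∀ i, V i) where
  Adj u v := ∃ i, (G i).Adj (u i) (v i) ∧ ∀ j, j ≠ i → u j = v j
  symm := ⟨fun _ _ ⟨i, h, e⟩ => ⟨i, h.symm, fun j hj => (e j hj).symm⟩⟩
  loopless := ⟨fun _ ⟨i, h, _⟩ => (G i).loopless.irrefl _ h⟩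

/-- The set `{a eᵢ : a ∈ Aᵢ, 1 ≤ i ≤ n}` of integral vectors modulo `diag(p, …, p)`. -/
def axisSteps {n : ℕ} (p : ℕ) (A : Fin n → Set (ZMod p)) :
    Set (IntVecMod (Matrix.diagonal fun _ : Fin n => (p : ℤ))) :=
  {x | ∃ (i : Fin n) (a : ℤ), (a : ZMod p) ∈ A i ∧ x = Submodule.Quotient.mk (Pi.single i a)}

/-- A regular abelian subgroup of the automorphism group of a (di)graph with adjacency relation
`r`: it is commutative, transitive on the vertices, and its order is the number of vertices. -/
def IsRegularAbelian {V : Type*} {r : V → V → Prop} (Ω : Subgroup (r ≃r r)) : Prop :=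
  (∀ σ ∈ Ω, ∀ τ ∈ Ω, σ * τ = τ * σ) ∧ (∀ u v : V, ∃ σ ∈ Ω, σ u = v) ∧ Nat.card Ω = Nat.card V

/-! An automorphism of a digraph is one of its underlying graph, and the underlying graph of the
product is the product of the connected underlying graphs. There distances add up coordinatewise, so
changing one coordinate of `u` to that of `v` gives a point on a geodesic from `u` to `v`. Lines are
geodesically closed, so the image of a line under an automorphism is closed under such changes: it
is a box. It has `p` points, a prime number, so it lies in a line. Hence automorphisms preserve
collinearity, and `exists_isMonomial` shows that they permute the coordinates and act on each
separately.

Let Ω be abelian of order `p ^ n`, acting faithfully in this way, with coordinate orbits of sizes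
`m_q`. The elements fixing all coordinate indices are determined by their components at one index
per orbit, each ranging in a `p`-subgroup of the symmetric group on `p` letters; so there are at
most `∏ p` of them. The abelian permutation group induced on the indices has order at most `∏ m_q`.
As `p * m < p ^ m` for `m > 1` and `∑ m_q = n`, the order `p ^ n` forces all `m_q = 1`; then Ω has
exponent `p` (`pow_eq_one_of_cocycle`).

The translations of any `G(M'; A')` isomorphic to the graph form such a group, so `(ℤ/pℤ)ⁿ` is a
quotient of `ℤᵏ`, whence `n ≤ k`. -/

namespace SimpleGraph

/-! ### Distances in cartesian products -/

section CartProd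

variable {ι : Type*} {V : ι → Type*} (H : ∀ i, SimpleGraph (V i))

/-- The embedding of a factor as a layer of a cartesian product. -/
def cartProdLayer [DecidableEq ι] (x : ∀ i, V i) (i : ι) : H i →g cartProd H where
  toFun a := Function.update x i a
  map_rel' {a b} h := ⟨i, by simpa using h, fun j hj => by simp [hj]⟩

variable {H}

theorem exists_walk_update [DecidableEq ι] (hH : ∀ i, (H i).Connected)
    (x : ∀ i, V i) (i : ι) (b : V i) :
    ∃ w : (cartProd H).Walk x (Function.update x i b), w.length = (H i).dist (x i) b := by
  obtain ⟨w, hw⟩ := (hH i).exists_walk_length_eq_dist (x i) b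
  have hx : cartProdLayer H x i (x i) = x := Function.update_eq_self i x
  have hb : cartProdLayer H x i b = Function.update x i b := rfl
  refine ⟨(w.map (cartProdLayer H x i)).copy hx hb, ?_⟩
  rw [Walk.length_copy, Walk.length_map, hw]

theorem exists_walk_cartProd [DecidableEq ι] (hH : ∀ i, (H i).Connected)
    (x y : ∀ i, V i) (s : Finset ι) :
    ∃ w : (cartProd H).Walk x (s.piecewise y x),
      w.length = ∑ i ∈ s, (H i).dist (x i) (y i) := by
  induction s using Finset.induction_on with
  | empty => exact ⟨Walk.nil.copy rfl (by simp), by simp⟩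
  | insert i s his ih =>
    obtain ⟨w, hw⟩ := ih
    obtain ⟨w', hw'⟩ := exists_walk_update hH (s.piecewise y x) i (y i)
    refine ⟨(w.append w').copy rfl (by rw [Finset.piecewise_insert]), ?_⟩
    rw [Finset.sum_insert his, Walk.length_copy, Walk.length_append, hw, hw']
    simp [his, add_comm]

/-- Each edge of the product changes a single coordinate, along an edge of that factor, so it
increases the sum by at most 1. -/
theorem sum_dist_le_length [Fintype ι] (hH : ∀ i, (H i).Connected) {x y : ∀ i, V i}
    (w : (cartProd H).Walk x y) : ∑ i, (H i).dist (x i) (y i) ≤ w.length := by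
  induction w with
  | nil => simp
  | @cons u v z h w ih =>
    have h1 : ∑ j, (H j).dist (u j) (v j) = 1 := by
      obtain ⟨i, hi, hj⟩ := h
      rw [Finset.sum_eq_single i (fun j _ hji => by simp [hj j hji]) (by simp)]
      exact dist_eq_one_iff_adj.mpr hi
    calc ∑ i, (H i).dist (u i) (z i)
        ≤ ∑ i, ((H i).dist (u i) (v i) + (H i).dist (v i) (z i)) :=
          Finset.sum_le_sum fun i _ => (hH i).dist_triangle
      _ ≤ (Walk.cons h w).length := by
          rw [Finset.sum_add_distrib, h1, Walk.length_cons]; omega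

/-- Distances add up in cartesian products. -/
theorem dist_cartProd [Fintype ι] (hH : ∀ i, (H i).Connected) (x y : ∀ i, V i) :
    (cartProd H).dist x y = ∑ i, (H i).dist (x i) (y i) := by
  classical
  have h := exists_walk_cartProd hH x y Finset.univ
  rw [Finset.piecewise_univ] at h
  obtain ⟨w, hw⟩ := h
  apply le_antisymm
  · exact hw ▸ dist_le w
  · obtain ⟨w', hw'⟩ := w.reachable.exists_walk_length_eq_dist
    exact hw' ▸ sum_dist_le_length hH w'

end CartProd

theorem Iso.dist_map {V W : Type*} {G : SimpleGraph V} {G' : SimpleGraph W} (e : G ≃g G')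
    (x y : V) : G'.dist (e x) (e y) = G.dist x y := by
  by_cases h : G.Reachable x y
  · apply le_antisymm
    · obtain ⟨w, hw⟩ := h.exists_walk_length_eq_dist
      rw [← hw, ← w.length_map e.toHom]
      exact dist_le _
    · obtain ⟨w, hw⟩ := ((e.reachable_iff).mpr h).exists_walk_length_eq_dist
      rw [← hw]
      have := dist_le ((w.map e.symm.toHom).copy (e.symm_apply_apply x) (e.symm_apply_apply y))
      simpa using this
  -- `dist` is 0 by convention between unreachable vertices.
  · rw [dist_eq_zero_of_not_reachable h,
      dist_eq_zero_of_not_reachable (fun h' => h (e.reachable_iff.mp h'))]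

end SimpleGraph

/-! ### Automorphisms preserve lines -/

/-- Two tuples are collinear if they differ in at most one coordinate. -/
def AreCollinear {ι : Type*} {V : ι → Type*} (x y : ∀ i, V i) : Prop :=
  ∀ i j, x i ≠ y i → x j ≠ y j → i = j

/-- A box whose number of points is prime is contained in a line. -/
theorem areCollinear_of_prime_card {ι : Type*} [Fintype ι] [DecidableEq ι] {V : ι → Type*}
    [∀ i, DecidableEq (V i)]
    (W : Finset (∀ i, V i)) (hW : W.card.Prime)
    (hmix : ∀ x ∈ W, ∀ y ∈ W, ∀ i, Function.update x i (y i) ∈ W)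
    {x y : ∀ i, V i} (hx : x ∈ W) (hy : y ∈ W) : AreCollinear x y := by
  have hbox : W = Fintype.piFinset fun i => W.image fun z => z i := by
    ext z
    simp only [Fintype.mem_piFinset, Finset.mem_image]
    refine ⟨fun hz i => ⟨z, hz, rfl⟩, fun hz => ?_⟩
    have key : ∀ s : Finset ι, s.piecewise z x ∈ W := by
      intro s
      induction s using Finset.induction_on with
      | empty => simpa using hx
      | insert i s _ ih =>
        obtain ⟨t, ht, hti⟩ := hz i
        rw [Finset.piecewise_insert, ← hti]
        exact hmix _ ih _ ht i
    simpa using key Finset.univ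
  intro i j hi hj
  by_contra hij
  have two_le : ∀ k, x k ≠ y k → 2 ≤ (W.image fun z => z k).card := fun k hk =>
    Finset.one_lt_card.mpr ⟨_, Finset.mem_image_of_mem _ hx, _, Finset.mem_image_of_mem _ hy, hk⟩
  have hcard : W.card = ∏ k, (W.image fun z => z k).card := by
    conv_lhs => rw [hbox]
    exact Fintype.card_piFinset _
  rw [← Finset.mul_prod_erase _ _ (Finset.mem_univ i),
    ← Finset.mul_prod_erase _ _ (Finset.mem_erase.mpr ⟨Ne.symm hij, Finset.mem_univ j⟩)] at hcard
  have h1 := two_le i hi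
  have h2 := two_le j hj
  -- Two coordinates that vary would give the prime two factors, each at least 2.
  rw [hcard] at hW
  rcases (Nat.prime_mul_iff.mp hW) with ⟨-, h⟩ | ⟨-, h⟩
  · have := Nat.eq_one_of_mul_eq_one_right h; omega
  · omega

/-- Automorphisms of a cartesian product of connected graphs of the same prime order map lines
into lines. -/
theorem SimpleGraph.Iso.areCollinear_map {ι F : Type*} [Fintype ι] [Fintype F]
    (hF : (Fintype.card F).Prime) {H : ι → SimpleGraph F} (hH : ∀ i, (H i).Connected)
    (σ : cartProd H ≃g cartProd H) {x y : ι → F} (hxy : AreCollinear x y) :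
    AreCollinear (σ x) (σ y) := by
  classical
  by_cases hne : x = y
  · intro i j hi; simp [hne] at hi
  obtain ⟨i, hi⟩ := Function.ne_iff.mp hne
  have hy : y = Function.update x i (y i) := by
    ext j
    by_cases hj : j = i
    · subst hj; simp
    · rw [Function.update_of_ne hj]
      by_contra h
      exact hj (hxy _ _ (Ne.symm h) hi)
  -- The image of the whole line through `x` in direction `i`.
  let W : Finset (ι → F) := Finset.univ.image fun a => σ (Function.update x i a)
  have hWcard : W.card = Fintype.card F :=
    Finset.card_image_of_injective _ (σ.injective.comp (Function.update_injective x i))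
  have memW : ∀ z, z ∈ W ↔ ∀ j, j ≠ i → σ.symm z j = x j := by
    intro z
    simp only [W, Finset.mem_image, Finset.mem_univ, true_and]
    constructor
    · rintro ⟨a, rfl⟩ j hj
      simp [hj]
    · intro h
      refine ⟨σ.symm z i, ?_⟩
      have : Function.update x i (σ.symm z i) = σ.symm z := by
        ext j
        by_cases hj : j = i
        · subst hj; simp
        · simp [hj, h j hj]
      rw [this, RelIso.apply_symm_apply]
  refine areCollinear_of_prime_card W (hWcard ▸ hF) ?_ ((memW _).mpr (by simp))
    ((memW _).mpr fun j hj => ?_)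
  · intro u hu v hv k
    rw [memW] at hu hv ⊢
    set m := Function.update u k (v k)
    have h1 : (cartProd H).dist u m + (cartProd H).dist m v = (cartProd H).dist u v := by
      simp only [dist_cartProd hH, ← Finset.sum_add_distrib]
      refine Finset.sum_congr rfl fun j _ => ?_
      by_cases hj : j = k
      · subst hj; simp [m]
      · simp [m, hj]
    rw [← σ.symm.dist_map u m, ← σ.symm.dist_map m v, ← σ.symm.dist_map u v] at h1
    simp only [dist_cartProd hH, ← Finset.sum_add_distrib] at h1
    intro j hj
    -- Equality in the sum of the triangle inequalities forces equality in each; off direction `i`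
    -- the two endpoints coincide, so the midpoint agrees with them.
    have h2 := (Finset.sum_eq_sum_iff_of_le (s := Finset.univ) (fun j _ =>
      (hH j).dist_triangle (u := σ.symm u j) (v := σ.symm m j) (w := σ.symm v j))).mp h1.symm j
      (Finset.mem_univ j)
    rw [hu j hj, hv j hj, dist_self] at h2
    have h3 : (H j).dist (x j) (σ.symm m j) = 0 := by omega
    exact (((hH j).dist_eq_zero_iff).mp h3).symm
  · rw [RelIso.symm_apply_apply, hy, Function.update_of_ne hj]

/-! ### Collinearity-preserving permutations are monomial -/

section Monomial

variable {ι F : Type*}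

/-- A map of tuples that permutes the coordinates by `π` and transforms the `i`-th one
by `f i`. -/
def IsMonomial (σ : (ι → F) → ι → F) (π : Equiv.Perm ι) (f : ι → Equiv.Perm F) : Prop :=
  ∀ x i, σ x (π i) = f i (x i)

theorem IsMonomial.comp {σ τ : (ι → F) → ι → F} {π ρ : Equiv.Perm ι} {f g : ι → Equiv.Perm F}
    (hσ : IsMonomial σ π f) (hτ : IsMonomial τ ρ g) :
    IsMonomial (σ ∘ τ) (π * ρ) fun i => f (ρ i) * g i := fun x i => by
  simp [hσ _ (ρ i), hτ x i]

theorem IsMonomial.unique [Nontrivial F] {σ : (ι → F) → ι → F} {π ρ : Equiv.Perm ι}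
    {f g : ι → Equiv.Perm F} (hσ : IsMonomial σ π f) (hτ : IsMonomial σ ρ g) :
    π = ρ ∧ f = g := by
  classical
  have hπ : π = ρ := by
    ext i
    by_contra hne
    obtain ⟨j, hj⟩ := ρ.surjective (π i)
    have hij : j ≠ i := by rintro rfl; exact hne hj.symm
    obtain ⟨a, b, hab⟩ := exists_pair_ne F
    have h : ∀ x : ι → F, f i (x i) = g j (x j) := fun x => by rw [← hσ x i, ← hτ x j, hj]
    have h1 := h fun _ => a
    have h2 := h (Function.update (fun _ => a) i b)
    rw [Function.update_self, Function.update_of_ne hij] at h2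
    exact hab ((f i).injective (h1.trans h2.symm))
  subst hπ
  refine ⟨rfl, ?_⟩
  ext i a
  rw [← hσ (fun _ => a) i, ← hτ (fun _ => a) i]

theorem areCollinear_update [DecidableEq ι] (x : ι → F) (i : ι) (a : F) :
    AreCollinear x (Function.update x i a) := by
  have h : ∀ j, x j ≠ Function.update x i a j → j = i := fun j hj => by
    by_contra hji
    exact hj (Function.update_of_ne hji a x).symm
  intro j k hj hk
  rw [h j hj, h k hk]

/-- A permutation of tuples that preserves collinearity is monomial. -/
theorem exists_isMonomial [Fintype ι] [Fintype F] (hF : 1 < Fintype.card F)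
    (σ : Equiv.Perm (ι → F))
    (hσ : ∀ x y, AreCollinear (σ x) (σ y) ↔ AreCollinear x y) :
    ∃ π f, IsMonomial σ π f := by
  classical
  have : Nontrivial F := Fintype.one_lt_card_iff_nontrivial.mp hF
  choose alt halt using fun a : F => exists_ne a
  -- the direction in which the image of `x` moves when its `i`-th coordinate moves
  have hdir : ∀ (x : ι → F) (i : ι), ∃ j, σ x j ≠ σ (Function.update x i (alt (x i))) j := by
    intro x i
    by_contra! h
    have h1 := congrFun (σ.injective (funext h)) i
    rw [Function.update_self] at h1
    exact halt _ h1.symm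
  choose d hd using hdir
  -- If moving `x i` to `a` changed another coordinate `k`, the images for `a` and `alt (x i)` would
  -- differ both at `k` and at `d x i`, although they are collinear.
  have agree : ∀ x i a k, k ≠ d x i → σ x k = σ (Function.update x i a) k := by
    intro x i a k hk
    by_contra hne
    have c1 := (hσ _ _).mpr (areCollinear_update x i (alt (x i)))
    have c3 : AreCollinear (σ (Function.update x i (alt (x i)))) (σ (Function.update x i a)) := by
      rw [hσ]
      simpa using areCollinear_update (Function.update x i (alt (x i))) i a
    have c2 := (hσ _ _).mpr (areCollinear_update x i a)
    have e1 : σ x k = σ (Function.update x i (alt (x i))) k := by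
      by_contra h; exact hk (c1 _ _ h (hd x i))
    have e2 : σ x (d x i) = σ (Function.update x i a) (d x i) := by
      by_contra h; exact hk (c2 _ _ hne h)
    exact hk (c3 _ _ (e1 ▸ hne) (e2 ▸ (hd x i).symm))
  have differ : ∀ x i a, a ≠ x i → σ x (d x i) ≠ σ (Function.update x i a) (d x i) := by
    intro x i a ha h
    have : σ x = σ (Function.update x i a) := by
      ext k
      by_cases hk : k = d x i
      · rw [hk, h]
      · exact agree x i a k hk
    have h1 := congrFun (σ.injective this) i
    rw [Function.update_self] at h1
    exact ha h1.symm
  have d_inj : ∀ x, Function.Injective (d x) := by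
    intro x i k hik
    by_contra hne
    have hc : AreCollinear (σ (Function.update x i (alt (x i))))
        (σ (Function.update x k (alt (x k)))) := by
      have h : ∀ j, σ (Function.update x i (alt (x i))) j ≠ σ (Function.update x k (alt (x k))) j →
          j = d x i := fun j hj => by
        by_contra hji
        exact hj ((agree x i _ j hji).symm.trans (agree x k _ j (hik ▸ hji)))
      intro j l hj hl
      rw [h j hj, h l hl]
    rw [hσ] at hc
    refine hne (hc i k ?_ ?_)
    · rw [Function.update_self, Function.update_of_ne hne]; exact halt _
    · rw [Function.update_self, Function.update_of_ne (Ne.symm hne)]; exact (halt _).symm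
  have d_update : ∀ x k b i, d (Function.update x k b) i = d x i := by
    intro x k b i
    by_cases hb : b = x k
    · rw [hb, Function.update_eq_self]
    by_cases hik : i = k
    · subst hik
      by_contra hne
      refine differ (Function.update x i b) i (x i) (by simpa using Ne.symm hb) ?_
      rw [Function.update_idem, Function.update_eq_self]
      exact (agree x i b _ hne).symm
    -- In the square `x`, `x'`, `y`, `y'` obtained by moving coordinates `i` and `k`, a change of
    -- direction makes the images of `y` and `y'` differ where those of `x` and `y` do, and finally
    -- forces `σ y' = σ x`.
    by_contra hne
    set y := Function.update x k b with hy
    set x' := Function.update x i (alt (x i)) with hx'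
    have hyi : y i = x i := Function.update_of_ne hik _ _
    have hx'k : x' k = x k := Function.update_of_ne (Ne.symm hik) _ _
    set y' := Function.update y i (alt (x i)) with hy'
    have hy'2 : y' = Function.update x' k b := by
      rw [hy', hy, hx', Function.update_comm hik]
    have hjl : d x i ≠ d x k := fun h => hik (d_inj x h)
    have s1 : σ x (d x i) = σ y (d x i) := agree x k b _ hjl
    have s2 : σ y (d x i) = σ y' (d x i) := agree y i _ _ (Ne.symm hne)
    have s3 : σ x (d x i) ≠ σ x' (d x i) := differ x i _ (halt _)
    have s4 : d x i = d x' k := by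
      by_contra h
      have := agree x' k b _ h
      rw [← hy'2] at this
      exact s3 (s1.trans (s2.trans this.symm))
    have s5 : σ x' (d x k) = σ y' (d x k) := by
      rw [hy'2]; exact agree x' k b _ (s4 ▸ hjl.symm)
    have s6 : σ x (d x k) = σ x' (d x k) := agree x i _ _ hjl.symm
    have s7 : σ x (d x k) ≠ σ y (d x k) := differ x k b hb
    have s8 : d x k = d y i := by
      by_contra h
      exact s7 (s6.trans (s5.trans (agree y i _ _ h).symm))
    have s9 : σ y' = σ x := by
      ext l
      by_cases hl : l = d x k
      · rw [hl, s6, s5]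
      · rw [agree x k b l hl, agree y i (alt (x i)) l (s8 ▸ hl)]
    have h1 := congrFun (σ.injective s9) i
    rw [hy', Function.update_self] at h1
    exact halt _ h1
  -- Moving from `x` to `y` one coordinate at a time keeps all directions, and the image coordinate
  -- `d x i` is untouched as long as `i` is not moved.
  have hind : ∀ (x y : ι → F) (i : ι) (s : Finset ι), d (s.piecewise y x) i = d x i ∧
      (i ∉ s → σ (s.piecewise y x) (d x i) = σ x (d x i)) := by
    intro x y i s
    induction s using Finset.induction_on with
    | empty => simp
    | insert j s _ ih =>
      rw [Finset.piecewise_insert, d_update]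
      refine ⟨ih.1, fun hi => ?_⟩
      rw [Finset.mem_insert, not_or] at hi
      rw [← ih.2 hi.2, ← ih.1]
      exact (agree _ j _ _ fun h => hi.1 (d_inj _ h)).symm
  have d_const : ∀ x y, d x = d y := fun x y => by
    ext i
    have := (hind y x i Finset.univ).1
    rwa [Finset.piecewise_univ] at this
  obtain ⟨a₀⟩ : Nonempty F := inferInstance
  set o : ι → F := fun _ => a₀
  let π : Equiv.Perm ι := Equiv.ofBijective (d o) (Finite.injective_iff_bijective.mp (d_inj o))
  let g : ι → F → F := fun i a => σ (Function.update o i a) (π i)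
  have hg : ∀ x i, σ x (π i) = g i (x i) := by
    intro x i
    have h := (hind (Function.update o i (x i)) x i (Finset.univ.erase i)).2 (by simp)
    have hx : (Finset.univ.erase i).piecewise x (Function.update o i (x i)) = x := by
      ext j
      by_cases hj : j = i
      · subst hj; simp
      · simp [hj]
    rw [hx, d_const _ o] at h
    exact h
  have g_inj : ∀ i, Function.Injective (g i) := by
    intro i a b hab
    have : σ (Function.update o i a) = σ (Function.update o i b) := by
      ext k
      obtain ⟨j, rfl⟩ := π.surjective k
      rw [hg, hg]
      by_cases hj : j = i
      · subst hj; simpa using hab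
      · simp [hj]
    exact Function.update_injective o i (σ.injective this)
  exact ⟨π, fun i => Equiv.ofBijective (g i) (Finite.injective_iff_bijective.mp (g_inj i)), hg⟩

end Monomial

/-! ### Abelian groups of monomial transformations -/

/-- Strictness rules out nontrivial coordinate orbits; for `p = m = 2` there is equality. -/
theorem Nat.mul_lt_pow_of_two_lt {p m : ℕ} (hp : 2 < p) (hm : 1 < m) : p * m < p ^ m := by
  induction m, hm using Nat.le_induction with
  | base => nlinarith
  | succ m hm ih =>
    have hm : 2 ≤ m := hm
    rw [pow_succ]
    calc p * (m + 1) ≤ p * m * p := by rw [mul_assoc]; exact Nat.mul_le_mul_left p (by nlinarith)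
      _ < p ^ m * p := Nat.mul_lt_mul_of_pos_right ih (by omega)

/-- A `p`-subgroup of the symmetric group on `p` letters has order at most `p`. -/
theorem card_dvd_of_perm_prime {p : ℕ} (hp : p.Prime) {F : Type*} [Fintype F]
    (hF : Fintype.card F = p) (S : Subgroup (Equiv.Perm F)) {n : ℕ} (hS : Nat.card S ∣ p ^ n) :
    Nat.card S ∣ p := by
  classical
  obtain ⟨m, -, hm⟩ := (Nat.dvd_prime_pow hp).mp hS
  have h1 : Nat.card S ∣ p.factorial := by
    have := Subgroup.card_subgroup_dvd_card S
    rwa [Nat.card_eq_fintype_card (α := Equiv.Perm F), Fintype.card_perm, hF] at this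
  rw [hm] at h1 ⊢
  have h2 : m ≤ 1 := by
    by_contra! h
    -- The prime `p` divides `p!` only once.
    have h3 : p * p ∣ p * (p - 1).factorial := by
      rw [Nat.mul_factorial_pred hp.ne_zero, ← sq]
      exact (pow_dvd_pow p h).trans h1
    have h4 := (hp.dvd_factorial).mp (Nat.dvd_of_mul_dvd_mul_left hp.pos h3)
    have := hp.pos
    omega
  simpa using pow_dvd_pow p h2

/-- A commutative group of order `p ^ n` that acts faithfully by monomial transformations of
`n`-tuples of elements of a set with `p > 2` elements has exponent `p`. -/
theorem pow_eq_one_of_cocycle {p : ℕ} (hp : p.Prime) (hp2 : 2 < p) {ι F Ω : Type*} [Fintype ι]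
    [Fintype F] (hF : Fintype.card F = p) [CommGroup Ω]
    (hΩ : Nat.card Ω = p ^ Fintype.card ι) (π : Ω →* Equiv.Perm ι) (f : Ω → ι → Equiv.Perm F)
    (hf : ∀ σ τ i, f (σ * τ) i = f σ (π τ i) * f τ i)
    (hfaith : ∀ σ, π σ = 1 → (∀ i, f σ i = 1) → σ = 1) (σ : Ω) : σ ^ p = 1 := by
  classical
  have : Finite Ω := Nat.finite_of_card_ne_zero (by rw [hΩ]; exact pow_ne_zero _ hp.ne_zero)
  let φ : ι → π.ker →* Equiv.Perm F := fun i => MonoidHom.mk' (fun k => f k i) fun k l => by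
    rw [Subgroup.coe_mul, hf, (MonoidHom.mem_ker).mp l.2]; rfl
  have hφ : ∀ i, Nat.card (φ i).range ∣ p := fun i =>
    card_dvd_of_perm_prime hp hF _ (n := Fintype.card ι)
      ((Subgroup.card_range_dvd (φ i)).trans (hΩ ▸ Subgroup.card_subgroup_dvd_card π.ker))
  -- By commutativity, the components of a kernel element along an orbit are conjugate, so one of
  -- them determines the others.
  have hconj : ∀ (k : π.ker) (τ : Ω) (i : ι),
      f k (π τ i) = f τ i * f k i * (f τ i)⁻¹ := by
    intro k τ i
    rw [eq_mul_inv_iff_mul_eq, ← hf, mul_comm, hf, (MonoidHom.mem_ker).mp k.2]; rfl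
  let Q := Quotient (MulAction.orbitRel π.range ι)
  have : Fintype Q := Fintype.ofFinite _
  have hrep : ∀ i : ι, ∃ τ : Ω, π τ (Quotient.out (s := MulAction.orbitRel π.range ι)
      (Quotient.mk _ i)) = i := by
    intro i
    obtain ⟨⟨_, τ, rfl⟩, hτ⟩ := (MulAction.orbitRel_apply (G := π.range)).mp
      ((MulAction.orbitRel π.range ι).symm' (Quotient.mk_out (s := MulAction.orbitRel π.range ι) i))
    exact ⟨τ, hτ⟩
  have hK : Nat.card π.ker ≤ ∏ _q : Q, p := by
    let Φ : π.ker → ∀ q : Q, (φ q.out).range := fun k q => ⟨φ q.out k, k, rfl⟩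
    have hΦ : Function.Injective Φ := by
      intro k l hkl
      rw [← mul_inv_eq_one]
      have key : ∀ m : π.ker, (∀ q : Q, φ q.out m = 1) → m = 1 := by
        intro m hm
        refine Subtype.ext (hfaith _ m.2 fun i => ?_)
        obtain ⟨τ, hτ⟩ := hrep i
        rw [← hτ, hconj]
        have : f m (Quotient.out (s := MulAction.orbitRel π.range ι) (Quotient.mk _ i)) = 1 :=
          hm _
        rw [this, mul_one, mul_inv_cancel]
      refine key _ fun q => ?_
      have := congrArg Subtype.val (congrFun hkl q)
      rw [map_mul, map_inv, mul_inv_eq_one]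
      exact this
    calc Nat.card π.ker ≤ Nat.card (∀ q : Q, (φ q.out).range) :=
          Nat.card_le_card_of_injective Φ hΦ
      _ = ∏ q : Q, Nat.card (φ q.out).range := Nat.card_pi
      _ ≤ ∏ _q : Q, p := Finset.prod_le_prod' fun q _ => Nat.le_of_dvd hp.pos (hφ _)
  -- In an abelian group `a (τ r) = τ (a r)`, so a permutation is determined by its values at the
  -- orbit representatives.
  have hR : Nat.card π.range ≤ ∏ q : Q, Nat.card (MulAction.orbit π.range q.out) := by
    let Ψ : π.range → ∀ q : Q, MulAction.orbit π.range q.out :=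
      fun g q => ⟨g • q.out, g, rfl⟩
    have hΨ : Function.Injective Ψ := by
      rintro ⟨_, a, rfl⟩ ⟨_, b, rfl⟩ hab
      ext i
      obtain ⟨τ, hτ⟩ := hrep i
      have h := congrArg Subtype.val (congrFun hab (Quotient.mk _ i))
      change π a _ = π b _ at h
      change π a i = π b i
      rw [← hτ, ← Equiv.Perm.mul_apply, ← Equiv.Perm.mul_apply, ← map_mul, ← map_mul,
        mul_comm a, mul_comm b, map_mul, map_mul, Equiv.Perm.mul_apply, Equiv.Perm.mul_apply, h]
    calc Nat.card π.range ≤ Nat.card (∀ q : Q, MulAction.orbit π.range q.out) :=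
          Nat.card_le_card_of_injective Ψ hΨ
      _ = _ := Nat.card_pi
  have hcount : Fintype.card ι = ∑ q : Q, Nat.card (MulAction.orbit π.range q.out) := by
    rw [← Nat.card_eq_fintype_card, Nat.card_congr (MulAction.selfEquivSigmaOrbits π.range ι),
      Nat.card_sigma]
  have hprod : Nat.card Ω = Nat.card π.ker * Nat.card π.range := by
    rw [← Subgroup.card_mul_index π.ker, Subgroup.index_ker]
  have horb_pos : ∀ q : Q, 0 < Nat.card (MulAction.orbit π.range q.out) := fun q => by
    have : Nonempty (MulAction.orbit π.range q.out) := ⟨⟨_, MulAction.mem_orbit_self _⟩⟩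
    exact Nat.card_pos
  have horb_le : ∀ q : Q, p * Nat.card (MulAction.orbit π.range q.out) ≤
      p ^ Nat.card (MulAction.orbit π.range q.out) := fun q => by
    rcases Nat.lt_or_ge 1 (Nat.card (MulAction.orbit π.range q.out)) with h | h
    · exact (Nat.mul_lt_pow_of_two_lt hp2 h).le
    · rw [le_antisymm h (horb_pos q)]; simp
  have horb : ∀ q : Q, Nat.card (MulAction.orbit π.range q.out) = 1 := by
    by_contra! h
    obtain ⟨q, hq⟩ := h
    -- The right side equals the order of Ω, while the left side bounds it from above.
    have hlt : ∏ q : Q, p * Nat.card (MulAction.orbit π.range q.out) <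
        ∏ q : Q, p ^ Nat.card (MulAction.orbit π.range q.out) :=
      Finset.prod_lt_prod (fun q _ => Nat.mul_pos hp.pos (horb_pos q)) (fun q _ => horb_le q)
        ⟨q, Finset.mem_univ q, Nat.mul_lt_pow_of_two_lt hp2 (by have := horb_pos q; omega)⟩
    rw [Finset.prod_pow_eq_pow_sum, ← hcount, ← hΩ, hprod, Finset.prod_mul_distrib] at hlt
    exact absurd (Nat.mul_le_mul hK hR) (not_le.mpr hlt)
  have hπ : ∀ τ, π τ = 1 := by
    intro τ
    have hfix : ∀ (q : Q) (g : Ω), π g q.out = q.out := by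
      intro q g
      have := (Nat.card_eq_one_iff_unique.mp (horb q)).1
      exact congrArg Subtype.val (Subsingleton.elim
        (⟨π g q.out, ⟨π g, g, rfl⟩, rfl⟩ : MulAction.orbit π.range q.out)
        ⟨q.out, MulAction.mem_orbit_self _⟩)
    ext i
    obtain ⟨ρ, hρ⟩ := hrep i
    have h := hfix (Quotient.mk _ i)
    rw [h] at hρ
    rw [← hρ]
    exact h τ
  let s : π.ker := ⟨σ, hπ σ⟩
  refine hfaith _ (hπ _) fun i => ?_
  have h1 : (⟨φ i s, s, rfl⟩ : (φ i).range) ^ p = 1 :=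
    orderOf_dvd_iff_pow_eq_one.mp ((orderOf_dvd_natCard _).trans (hφ i))
  have h2 : φ i (s ^ p) = 1 := by
    rw [map_pow]; exact congrArg Subtype.val h1
  exact h2

/-! ### Elementary abelian groups -/

/-- A `ℤ/pℤ`-module of order `p ^ n` is isomorphic to `(ℤ/pℤ)ⁿ`. -/
theorem nonempty_addEquiv_of_zmodModule {p n : ℕ} (hp : p.Prime) {B : Type*} [AddCommGroup B]
    [Module (ZMod p) B] (hB : Nat.card B = p ^ n) : Nonempty (B ≃+ (Fin n → ZMod p)) := by
  have := Fact.mk hp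
  have : Finite B := Nat.finite_of_card_ne_zero (by rw [hB]; exact pow_ne_zero _ hp.ne_zero)
  have hc := Module.natCard_eq_pow_finrank (K := ZMod p) (V := B)
  rw [Nat.card_zmod] at hc
  have hn : Module.finrank (ZMod p) B = n := Nat.pow_right_injective hp.two_le (hc.symm.trans hB)
  obtain ⟨e⟩ : Nonempty (B ≃ₗ[ZMod p] (Fin n → ZMod p)) :=
    FiniteDimensional.nonempty_linearEquiv_of_finrank_eq (by rw [hn]; simp)
  exact ⟨e.toAddEquiv⟩

/-- A finite commutative group of order `p ^ n` and exponent `p` is elementary abelian. -/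
theorem nonempty_mulEquiv_of_pow_eq_one {p n : ℕ} (hp : p.Prime) {Ω : Type*} [CommGroup Ω]
    (hΩ : Nat.card Ω = p ^ n) (h : ∀ σ : Ω, σ ^ p = 1) :
    Nonempty (Ω ≃* Multiplicative (Fin n → ZMod p)) := by
  let _ := AddCommGroup.zmodModule (n := p) (G := Additive Ω) fun x => h x.toMul
  obtain ⟨e⟩ := nonempty_addEquiv_of_zmodModule hp (B := Additive Ω) hΩ
  exact ⟨AddEquiv.toMultiplicativeRight e⟩

/-- The rank of an elementary abelian quotient of `ℤᵏ` is at most `k`. -/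
theorem le_of_surjective_int {p n k : ℕ} (hp : p.Prime) (g : (Fin k → ℤ) →+ (Fin n → ZMod p))
    (hg : Function.Surjective g) : n ≤ k := by
  have := Fact.mk hp
  let b : Fin k → Fin n → ZMod p := fun i => g (Pi.single i 1)
  -- The images of the `k` unit vectors span, so the dimension `n` is at most `k`.
  have hb : Submodule.span (ZMod p) (Set.range b) = ⊤ := by
    rw [eq_top_iff]
    rintro y -
    obtain ⟨x, rfl⟩ := hg y
    have hx : x = ∑ i, x i • (Pi.single i (1 : ℤ) : Fin k → ℤ) := by
      simpa using pi_eq_sum_univ' x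
    rw [hx, map_sum]
    refine Submodule.sum_mem _ fun i _ => ?_
    rw [map_zsmul]
    exact zsmul_mem (Submodule.subset_span (Set.mem_range_self i)) _
  have h := finrank_range_le_card (R := ZMod p) b
  rw [Set.finrank, hb, finrank_top] at h
  simpa using h

/-! ### Regular abelian groups of automorphisms -/

section Automorphisms

variable {p n : ℕ}

/-- A commutative group of order `p ^ n` that acts faithfully by automorphisms on the cartesian
product of `n` connected graphs with `p > 2` vertices is elementary abelian. -/
theorem nonempty_mulEquiv_of_aut_cartProd (hp : p.Prime) (hp2 : 2 < p)
    {H : Fin n → SimpleGraph (ZMod p)} (hH : ∀ i, (H i).Connected) {Ω : Type*} [CommGroup Ω]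
    (hΩ : Nat.card Ω = p ^ n) (ρ : Ω →* Equiv.Perm (Fin n → ZMod p))
    (hρ : Function.Injective ρ)
    (hadj : ∀ σ x y, (SimpleGraph.cartProd H).Adj (ρ σ x) (ρ σ y) ↔
      (SimpleGraph.cartProd H).Adj x y) :
    Nonempty (Ω ≃* Multiplicative (Fin n → ZMod p)) := by
  have := Fact.mk hp
  have hcol : ∀ σ x y, AreCollinear x y → AreCollinear (ρ σ x) (ρ σ y) := fun σ x y h =>
    SimpleGraph.Iso.areCollinear_map (by rwa [ZMod.card]) hH
      (⟨ρ σ, hadj σ _ _⟩ : SimpleGraph.cartProd H ≃g SimpleGraph.cartProd H) h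
  have hmono : ∀ σ, ∃ π f, IsMonomial (ρ σ) π f := fun σ =>
    exists_isMonomial (by rw [ZMod.card]; exact hp.one_lt) (ρ σ) fun x y =>
      ⟨fun h => by simpa [← Equiv.Perm.mul_apply, ← map_mul] using hcol σ⁻¹ _ _ h, hcol σ x y⟩
  choose π f hπf using hmono
  -- Uniqueness of the monomial form makes `π` a homomorphism and `f` a cocycle over it.
  have hmul : ∀ σ τ, π (σ * τ) = π σ * π τ ∧ f (σ * τ) = fun i => f σ (π τ i) * f τ i :=
    fun σ τ => (hπf (σ * τ)).unique (by
      have := (hπf σ).comp (hπf τ)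
      rwa [← Equiv.Perm.coe_mul, ← map_mul] at this)
  refine nonempty_mulEquiv_of_pow_eq_one hp hΩ (pow_eq_one_of_cocycle (ι := Fin n) (F := ZMod p)
    hp hp2 (ZMod.card p) (by simpa using hΩ) (MonoidHom.mk' π fun σ τ => (hmul σ τ).1) f
    (fun σ τ i => congrFun (hmul σ τ).2 i) fun σ h1 h2 => hρ ?_)
  rw [map_one]
  ext x i
  have h := hπf σ x i
  change π σ = 1 at h1
  simp only [h1, h2, Equiv.Perm.one_apply] at h
  rw [h, Equiv.Perm.one_apply]

/-- If a relation is identified with a relation on `n`-tuples whose automorphisms are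
automorphisms of the cartesian product of `n` connected graphs with `p > 2` vertices, then
all its regular abelian groups of automorphisms are elementary abelian. -/
theorem IsRegularAbelian.nonempty_mulEquiv (hp : p.Prime) (hp2 : 2 < p)
    {H : Fin n → SimpleGraph (ZMod p)} (hH : ∀ i, (H i).Connected) {V : Type*}
    {r : V → V → Prop} (e : V ≃ (Fin n → ZMod p))
    (hr : ∀ u v, (SimpleGraph.cartProd H).Adj (e u) (e v) ↔ r u v ∨ r v u)
    {Ω : Subgroup (r ≃r r)} (hΩ : IsRegularAbelian Ω) :
    Nonempty (Ω ≃* Multiplicative (Fin n → ZMod p)) := by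
  let _ : CommGroup Ω :=
    { (inferInstance : Group Ω) with
      mul_comm := fun σ τ => Subtype.ext (hΩ.1 _ σ.2 _ τ.2) }
  let ρ : Ω →* Equiv.Perm (Fin n → ZMod p) := MonoidHom.mk'
    (fun σ => e.symm.trans ((σ : r ≃r r).toEquiv.trans e)) fun σ τ => by
      ext x
      simp
  refine nonempty_mulEquiv_of_aut_cartProd hp hp2 hH ?_ ρ (fun σ τ h => ?_) fun σ x y => ?_
  · rw [hΩ.2.2, Nat.card_congr e, Nat.card_fun, Nat.card_zmod, Nat.card_fin]
  · ext v
    have := congrArg e.symm (Equiv.congr_fun h (e v))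
    simpa [ρ] using this
  · have h1 := hr ((σ : r ≃r r) (e.symm x)) ((σ : r ≃r r) (e.symm y))
    have h2 := hr (e.symm x) (e.symm y)
    rw [e.apply_symm_apply, e.apply_symm_apply] at h2
    rw [h2]
    refine h1.trans ?_
    rw [(σ : r ≃r r).map_rel_iff, (σ : r ≃r r).map_rel_iff]

/-- Translations form a regular abelian group of automorphisms of a Cayley relation, and
of each relation isomorphic to it. -/
theorem exists_isRegularAbelian {Γ V : Type*} [AddCommGroup Γ] {s : Γ → Γ → Prop}
    (hs : ∀ a u v, s (a + u) (a + v) ↔ s u v) {r : V → V → Prop} (e : r ≃r s) :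
    ∃ Ω : Subgroup (r ≃r r), IsRegularAbelian Ω ∧ Nonempty (Multiplicative Γ ≃* Ω) := by
  let t : Multiplicative Γ →* (r ≃r r) := MonoidHom.mk'
    (fun a => ⟨e.toEquiv.trans ((Equiv.addLeft a.toAdd).trans e.symm.toEquiv), by
      intro u v
      rw [← e.map_rel_iff, ← e.map_rel_iff (a := u)]
      simpa using hs _ _ _⟩) fun a b => by
      ext v
      simp [RelIso.mul_def]
  have ht : ∀ a v, t a v = e.symm (a.toAdd + e v) := fun _ _ => rfl
  have hinj : Function.Injective t := fun a b h => by
    have := congrArg e (congrArg (fun f : r ≃r r => f (e.symm 0)) h)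
    simpa [ht] using this
  refine ⟨t.range, ⟨?_, fun u v => ?_, ?_⟩, ⟨MonoidHom.ofInjective hinj⟩⟩
  · rintro _ ⟨a, rfl⟩ _ ⟨b, rfl⟩
    rw [← map_mul, ← map_mul, mul_comm]
  · exact ⟨t (Multiplicative.ofAdd (e v - e u)), ⟨_, rfl⟩, by rw [ht]; simp⟩
  · rw [← Nat.card_congr (MonoidHom.ofInjective hinj).toEquiv, Nat.card_congr e.toEquiv]
    rfl

/-- If all regular abelian groups of automorphisms of a relation are isomorphic to
`(ℤ/pℤ)ⁿ`, then it is not isomorphic to a Cayley relation on `ℤᵏ / Mℤᵏ` with `k < n`. -/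
theorem le_of_relIso_intVecMod (hp : p.Prime) {V : Type*} {r : V → V → Prop}
    (hr : ∀ Ω : Subgroup (r ≃r r), IsRegularAbelian Ω →
      Nonempty (Ω ≃* Multiplicative (Fin n → ZMod p)))
    {k : ℕ} {M : Matrix (Fin k) (Fin k) ℤ} {s : IntVecMod M → IntVecMod M → Prop}
    (hs : ∀ a u v, s (a + u) (a + v) ↔ s u v) (e : r ≃r s) : n ≤ k := by
  obtain ⟨Ω, hΩ, ⟨f⟩⟩ := exists_isRegularAbelian hs e
  obtain ⟨g⟩ := hr Ω hΩ
  let h : IntVecMod M ≃+ (Fin n → ZMod p) := MulEquiv.toAdditive (f.trans g)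
  exact le_of_surjective_int hp
    (h.toAddMonoidHom.comp (Submodule.mkQ (LinearMap.range M.mulVecLin)).toAddMonoidHom)
    (h.surjective.comp (Submodule.mkQ_surjective _))

end Automorphisms

/-! ### Integral vectors modulo `diag(p, …, p)` and the theorem -/

section Main

variable {p n : ℕ}

/-- Coordinatewise reduction modulo `p`. -/
def intVecToZMod (p n : ℕ) : (Fin n → ℤ) →ₗ[ℤ] (Fin n → ZMod p) where
  toFun x i := x i
  map_add' x y := by ext i; simp
  map_smul' c x := by ext i; simp

theorem range_diagonal_eq_ker (p n : ℕ) :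
    LinearMap.range (Matrix.diagonal fun _ : Fin n => (p : ℤ)).mulVecLin =
      LinearMap.ker (intVecToZMod p n) := by
  ext x
  simp only [LinearMap.mem_range, LinearMap.mem_ker, Matrix.mulVecLin_apply]
  constructor
  · rintro ⟨y, rfl⟩
    ext i
    simp [intVecToZMod]
  · intro h
    have h1 : ∀ i, (p : ℤ) ∣ x i := fun i =>
      (ZMod.intCast_zmod_eq_zero_iff_dvd _ _).mp (congrFun h i)
    choose y hy using h1
    exact ⟨y, by ext i; rw [Matrix.mulVec_diagonal, hy]⟩

/-- The group of integral vectors modulo `diag(p, …, p)` is `(ℤ/pℤ)ⁿ`. -/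
noncomputable def intVecModEquiv (p n : ℕ) :
    IntVecMod (Matrix.diagonal fun _ : Fin n => (p : ℤ)) ≃ₗ[ℤ] (Fin n → ZMod p) :=
  (Submodule.quotEquivOfEq _ _ (range_diagonal_eq_ker p n)).trans
    ((intVecToZMod p n).quotKerEquivOfSurjective fun y =>
      ⟨fun i => (ZMod.intCast_surjective (y i)).choose, by
        ext i; exact (ZMod.intCast_surjective (y i)).choose_spec⟩)

theorem intVecModEquiv_mk (x : Fin n → ℤ) (i : Fin n) :
    intVecModEquiv p n (Submodule.Quotient.mk x) i = x i := rfl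

theorem mem_axisSteps (A : Fin n → Set (ZMod p))
    (x : IntVecMod (Matrix.diagonal fun _ : Fin n => (p : ℤ))) :
    x ∈ axisSteps p A ↔ ∃ i, intVecModEquiv p n x i ∈ A i ∧
      ∀ j, j ≠ i → intVecModEquiv p n x j = 0 := by
  constructor
  · rintro ⟨i, a, ha, rfl⟩
    refine ⟨i, by simpa [intVecModEquiv_mk] using ha, fun j hj => ?_⟩
    rw [intVecModEquiv_mk, Pi.single_eq_of_ne hj, Int.cast_zero]
  · rintro ⟨i, hi, hj⟩
    obtain ⟨a, ha⟩ := ZMod.intCast_surjective (intVecModEquiv p n x i)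
    refine ⟨i, a, ha ▸ hi, (intVecModEquiv p n).injective ?_⟩
    ext j
    rw [intVecModEquiv_mk]
    by_cases h : j = i
    · subst h; rw [Pi.single_eq_same, ha]
    · rw [hj j h, Pi.single_eq_of_ne h, Int.cast_zero]

theorem sub_mem_axisSteps (A : Fin n → Set (ZMod p))
    (u v : IntVecMod (Matrix.diagonal fun _ : Fin n => (p : ℤ))) :
    v - u ∈ axisSteps p A ↔ ∃ i, intVecModEquiv p n v i - intVecModEquiv p n u i ∈ A i ∧
      ∀ j, j ≠ i → intVecModEquiv p n u j = intVecModEquiv p n v j := by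
  rw [mem_axisSteps]
  simp only [map_sub, Pi.sub_apply]
  exact exists_congr fun i => and_congr Iff.rfl
    (forall₂_congr fun j _ => sub_eq_zero.trans eq_comm)

theorem zero_notMem_axisSteps {A : Fin n → Set (ZMod p)} (hA0 : ∀ i, 0 ∉ A i) :
    0 ∉ axisSteps p A := by
  rw [mem_axisSteps]
  rintro ⟨i, hi, -⟩
  exact hA0 i (by simpa using hi)

theorem neg_axisSteps {A : Fin n → Set (ZMod p)} (hA : ∀ i, -A i = A i) :
    -axisSteps p A = axisSteps p A := by
  ext x
  rw [Set.mem_neg, mem_axisSteps, mem_axisSteps]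
  simp only [map_neg, Pi.neg_apply, neg_eq_zero, ← Set.mem_neg, hA]

theorem det_diagonal_ne_zero (hp : p.Prime) :
    (Matrix.diagonal fun _ : Fin n => (p : ℤ)).det ≠ 0 := by
  simp [Matrix.det_diagonal, hp.ne_zero]

/-- `circulantGraph` symmetrizes the steps and discards loops; neither has an effect under these
hypotheses. -/
theorem circulantGraph_adj_iff {Γ : Type*} [AddCommGroup Γ] {A : Set Γ} (h0 : 0 ∉ A)
    (hA : -A = A) (u v : Γ) : (SimpleGraph.circulantGraph A).Adj u v ↔ v - u ∈ A := by
  rw [SimpleGraph.circulantGraph_adj]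
  constructor
  · rintro ⟨-, h⟩
    rcases h with h | h
    · rwa [← hA, Set.mem_neg, neg_sub]
    · exact h
  · exact fun h => ⟨fun huv => h0 (by simpa [huv] using h), Or.inr h⟩

theorem multiCircDigraph_adj_add_left {k : ℕ} {M : Matrix (Fin k) (Fin k) ℤ}
    (A : Set (IntVecMod M)) (a u v : IntVecMod M) :
    (multiCircDigraph M A).Adj (a + u) (a + v) ↔ (multiCircDigraph M A).Adj u v := by
  simp [multiCircDigraph, stepDigraph]

theorem multiCircGraph_adj_add_left {k : ℕ} {M : Matrix (Fin k) (Fin k) ℤ}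
    (A : Set (IntVecMod M)) (a u v : IntVecMod M) :
    (multiCircGraph M A).Adj (a + u) (a + v) ↔ (multiCircGraph M A).Adj u v := by
  simp [multiCircGraph]

end Main

theorem theorem3p7 (p : ℕ) (hp : p.Prime) (hp2 : 2 < p) (n : ℕ)
    (A : Fin n → Set (ZMod p)) (hA0 : ∀ i, 0 ∉ A i) :
    -- the case of digraphs
    ((∀ i, (circDigraph p (A i)).toSimpleGraphInclusive.Connected) →
      Nonempty ((multiCircDigraph _ (axisSteps p A)).Adj ≃r
        (Digraph.cartProd fun i => circDigraph p (A i)).Adj) ∧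
      (multiCircDigraph _ (axisSteps p A)).HasCircDim n ∧
      ∀ Ω : Subgroup ((multiCircDigraph _ (axisSteps p A)).Adj ≃r
          (multiCircDigraph _ (axisSteps p A)).Adj),
        IsRegularAbelian Ω → Nonempty (Ω ≃* Multiplicative (Fin n → ZMod p))) ∧
    -- the case of graphs
    ((∀ i, -A i = A i) → (∀ i, (circGraph p (A i)).Connected) →
      Nonempty (multiCircGraph _ (axisSteps p A) ≃g
        SimpleGraph.cartProd fun i => circGraph p (A i)) ∧
      (multiCircGraph _ (axisSteps p A)).HasCircDim n ∧
      ∀ Ω : Subgroup (multiCircGraph _ (axisSteps p A) ≃g multiCircGraph _ (axisSteps p A)),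
        IsRegularAbelian Ω → Nonempty (Ω ≃* Multiplicative (Fin n → ZMod p))) := by
  let e := (intVecModEquiv p n).toEquiv
  constructor
  · intro hconn
    have hreg : ∀ Ω : Subgroup ((multiCircDigraph _ (axisSteps p A)).Adj ≃r
        (multiCircDigraph _ (axisSteps p A)).Adj), IsRegularAbelian Ω →
        Nonempty (Ω ≃* Multiplicative (Fin n → ZMod p)) := fun Ω hΩ => by
      -- The factors are the underlying graphs of the circulant digraphs; two vertices are adjacent
      -- in their product iff there is an arc between them in some direction.
      refine hΩ.nonempty_mulEquiv hp hp2 hconn e fun u v => ?_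
      change _ ↔ v - u ∈ axisSteps p A ∨ u - v ∈ axisSteps p A
      rw [sub_mem_axisSteps, sub_mem_axisSteps, ← exists_or]
      refine exists_congr fun i => ?_
      have h1 : (circDigraph p (A i)).toSimpleGraphInclusive.Adj (e u i) (e v i) ↔
          e v i - e u i ∈ A i ∨ e u i - e v i ∈ A i := by
        refine ⟨fun h => h.2, fun h => ⟨fun huv => ?_, h⟩⟩
        rw [huv, sub_self, or_self] at h
        exact hA0 i h
      rw [h1, or_and_right]
      refine or_congr Iff.rfl (and_congr Iff.rfl (forall₂_congr fun j _ => eq_comm))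
    refine ⟨⟨⟨e, fun {u v} => (sub_mem_axisSteps A u v).symm⟩⟩,
      ⟨⟨_, axisSteps p A, det_diagonal_ne_zero hp, zero_notMem_axisSteps hA0,
        ⟨RelIso.refl _⟩⟩, ?_⟩, hreg⟩
    rintro k ⟨M, B, -, -, ⟨f⟩⟩
    exact le_of_relIso_intVecMod hp hreg (multiCircDigraph_adj_add_left B) f
  · intro hA hconn
    have hadj : ∀ u v, (SimpleGraph.cartProd fun i => circGraph p (A i)).Adj (e u) (e v) ↔
        (multiCircGraph _ (axisSteps p A)).Adj u v := fun u v => by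
      rw [multiCircGraph, circulantGraph_adj_iff (zero_notMem_axisSteps hA0) (neg_axisSteps hA),
        sub_mem_axisSteps]
      exact exists_congr fun i => and_congr (circulantGraph_adj_iff (hA0 i) (hA i) _ _) Iff.rfl
    have hreg : ∀ Ω : Subgroup (multiCircGraph _ (axisSteps p A) ≃g
        multiCircGraph _ (axisSteps p A)), IsRegularAbelian Ω →
        Nonempty (Ω ≃* Multiplicative (Fin n → ZMod p)) := fun Ω hΩ =>
      hΩ.nonempty_mulEquiv hp hp2 hconn e fun u v => by
        rw [hadj, SimpleGraph.adj_comm _ v u, or_self]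
    refine ⟨⟨⟨e, fun {u v} => hadj u v⟩⟩,
      ⟨⟨_, axisSteps p A, det_diagonal_ne_zero hp, zero_notMem_axisSteps hA0, neg_axisSteps hA,
        ⟨RelIso.refl _⟩⟩, ?_⟩, hreg⟩
    rintro k ⟨M, B, -, -, -, ⟨f⟩⟩
    exact le_of_relIso_intVecMod hp hreg (multiCircGraph_adj_add_left B) f
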